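/- Let $\xi>0$, $d\ge 1$, and let $\mathbf X=(X_i)_{i=1}^d$ be an (a.s.) nonnegative random vector such that $\mathbf Z:=(X_i^{1/\xi})_{i=1}^d$ is regularly varying with exponent $1$, written $\mathbf Z\in RV_1(\{b_n\},\nu)$. This means: $b_n\ge 0$, $b_n\uparrow\infty$; $\nu$ is a non-zero Borel measure on $\mathbb R^d\setminus\{\mathbf 0\}$, finite on Borel sets bounded away from $\mathbf 0$; $n\,\mathbb P(b_n^{-1}\mathbf Z\in A)\to\nu(A)$ for every Borel set $A$ bounded away from $\mathbf 0$ with $\nu(\partial A)=0$; and $\nu(tA)=t^{-1}\nu(A)$ for all $t>0$ and all Borel $A$. Fix a norm $\|\cdot\|$ on $\mathbb R^d$, put $\mathbb S^+:=\{\mathbf u\ge\mathbf 0:\|\mathbf u\|=1\}$ and $c:=\nu\{\|\mathbf x\|>1\}$, and let $$\sigma_{\mathbf Z}(B):=\nu\{\|\mathbf x\|>1,\ \mathbf x/\|\mathbf x\|\in B\}/c$$ be the spectral measure of $\mathbf Z$. Then $0<c<\infty$, $\sigma_{\mathbf Z}$ is a probability measure concentrated on $\mathbb S^+$, and $\nu(d\mathbf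 x)=c\,r^{-2}dr\,\sigma_{\mathbf Z}(d\mathbf u)$ in the polar coordinates $(r,\mathbf u)=(\|\mathbf x\|,\mathbf x/\|\mathbf x\|)$. Moreover: (1) Let $h:[0,\infty)^d\to[0,\infty)$ be Borel measurable and $\xi$-homogeneous, i.e. $h(t\mathbf x)=t^{\xi}h(\mathbf x)$ for all $t>0$, bounded on $\mathbb S^+$ and continuous at $\nu$-almost every point of $[0,\infty)^d$ (all the regularity holds, for instance, if $h$ is continuous). Then $\rho(h):=\int_{\mathbb S^+}h(\mathbf u)^{1/\xi}\,\sigma_{\mathbf Z}(d\mathbf u)$ is finite and, for all $s>0$, $$n\,\mathbb P\big(b_n^{-\xi}h(\mathbf Z)>s\big)\longrightarrow c\,\rho(h)\,s^{-1/\xi},\qquad n\to\infty.$$ (2) Suppose that $\nu\{\mathbf x: x_1\ne 0\}>0$, and let $w_1,\dots,w_d\ge 0$. Then $\sigma_1:=\int_{\mathbb S^+}u_1\,\sigma_{\mathbf Z}(d\mathbf u)\in(0,\infty)$, $\mathbb P(X_1>x)>0$ for all real $x$, the integral on the right below is finite, and $$\lim_{x\to\infty}\frac{\mathbb P\big(\sum_{i=1}^d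 w_iX_i>x\big)}{\mathbb P(X_1>x)}=\frac1{\sigma_1}\int_{\mathbb S^+}\Big(\sum_{i=1}^d w_iu_i^{\xi}\Big)^{1/\xi}\sigma_{\mathbf Z}(d\mathbf u).$$ -/

import Mathlib

open MeasureTheory Filter Topology Set
open scoped ENNReal Pointwise

/-- `Z` is multivariate regularly varying on `ℝ^d` with exponent `α`, normalising sequence `b`
and limit measure `ν`. A Borel measure on `ℝ^d \ {0}` is a Borel measure on `ℝ^d` that does not
charge the origin. -/
structure IsRegVarying {Ω : Type*} [MeasurableSpace Ω] (P : Measure Ω) {d : ℕ} (α : ℝ)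
    (Z : Ω → Fin d → ℝ) (b : ℕ → ℝ) (ν : Measure (Fin d → ℝ)) : Prop where
  /-- `Z` is a random vector -/
  measurable : Measurable Z
  /-- the normalising sequence is nonnegative and increases to infinity -/
  norm_nonneg : ∀ n, 0 ≤ b n
  norm_mono : Monotone b
  norm_tendsto : Tendsto b atTop atTop
  /-- `ν` is a non-zero measure on `ℝ^d \ {0}` -/
  zero_null : ν {0} = 0
  ne_zero : ν ≠ 0
  /-- `ν` is finite on the Borel sets bounded away from the origin -/
  finite_away : ∀ A : Set (Fin d → ℝ), MeasurableSet A →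
    (∃ ε > 0, A ⊆ (Metric.ball 0 ε)ᶜ) → ν A < ∞
  /-- convergence on the `ν`-continuity sets bounded away from the origin -/
  tendsto : ∀ A : Set (Fin d → ℝ), MeasurableSet A →
    (∃ ε > 0, A ⊆ (Metric.ball 0 ε)ᶜ) → ν (frontier A) = 0 →
    Tendsto (fun n : ℕ => (n : ℝ≥0∞) * P {ω | (b n)⁻¹ • Z ω ∈ A}) atTop (𝓝 (ν A))
  /-- `α` is the exponent of regular variation, that is, the exponent in the scaling property -/
  scaling : ∀ t : ℝ, 0 < t → ∀ A : Set (Fin d → ℝ), MeasurableSet A →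
    ν (t • A) = ENNReal.ofReal (t ^ (-α)) * ν A

/-- The positive unit sphere `{u ≥ 0 : N u = 1}` of the norm `N`. -/
def posSphere {d : ℕ} (N : Seminorm ℝ (Fin d → ℝ)) : Set (Fin d → ℝ) :=
  {u | 0 ≤ u ∧ N u = 1}

/-- The spectral measure of `ν` with respect to the norm `N`:
`σ(B) = ν{N x > 1, x / N x ∈ B} / ν{N x > 1}`. -/
noncomputable def spectralMeasure {d : ℕ} (N : Seminorm ℝ (Fin d → ℝ))
    (ν : Measure (Fin d → ℝ)) : Measure (Fin d → ℝ) :=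
  (ν {x | 1 < N x})⁻¹ • (ν.restrict {x | 1 < N x}).map (fun x => (N x)⁻¹ • x)

/-! Scaling says that pushing `ν` forward by `x ↦ s • x` multiplies it by `s`. This gives the polar
decomposition directly: lift the spectral measure back to `ν` on `{N > 1}`, substitute `r = N x *
s`, and swap integrals (`measure_eq_lintegral_polar`).

For a homogeneous `g`, the level sets `{g = s}`, `s > 0`, are dilates of one another, so all are
null or all are charged; a σ-finite measure charges only countably many, so all are null. Hence `{g
> s}` is a `ν`-continuity set, bounded away from the origin by homogeneity, and regular variation
applies to it. In polar coordinates the ray through `u` meets this set beyond radius `(s / g u) ^ (1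
/ ξ)`, and the `r⁻²` tail there is `(g u / s) ^ (1 / ξ)`; integrating over `u` gives (1).

For (2), numerator and denominator are both portfolios, with weights `w` and the first unit vector.
Applying (1) to `∑ w i * x i ^ ξ` gives their tails along the thresholds `b n ^ ξ`; monotonicity of
the tails passes to real thresholds, and the common constant `c` cancels in the ratio. -/

theorem not_countable_Ioi_real (a : ℝ) : ¬ (Ioi a).Countable := by
  rw [← Cardinal.le_aleph0_iff_set_countable, Cardinal.mk_Ioi_real, not_le]
  exact Cardinal.aleph0_lt_continuum

/-! ### Comparison of an arbitrary norm with the sup norm -/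

section Norm

variable {d : ℕ}

theorem Seminorm.continuous_pi_real (N : Seminorm ℝ (Fin d → ℝ)) : Continuous N := by
  rw [← continuousOn_univ]
  exact N.convexOn.continuousOn isOpen_univ

theorem Seminorm.exists_le_mul_norm (N : Seminorm ℝ (Fin d → ℝ)) :
    ∃ K > 0, ∀ x, N x ≤ K * ‖x‖ :=
  Seminorm.bound_of_continuous_normedSpace N N.continuous_pi_real

theorem Seminorm.exists_norm_le_mul (N : Seminorm ℝ (Fin d → ℝ)) (hN : ∀ x, N x = 0 → x = 0) :
    ∃ k > 0, ∀ x, ‖x‖ ≤ k * N x := by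
  obtain ⟨m, hm, hmin⟩ := (isCompact_sphere (0 : Fin d → ℝ) 1).exists_forall_le'
    N.continuous_pi_real.continuousOn (a := 0) (fun x hx =>
      (apply_nonneg N x).lt_of_ne' fun h => by
        have := hN x h
        simp [this] at hx)
  refine ⟨m⁻¹, inv_pos.2 hm, fun x => ?_⟩
  rcases eq_or_ne x 0 with rfl | hx
  · simp
  have hx' : 0 < ‖x‖ := norm_pos_iff.2 hx
  have h := hmin (‖x‖⁻¹ • x) (by simp [norm_smul, hx'.ne'])
  rw [map_smul_eq_mul, norm_inv, norm_norm, inv_mul_eq_div, le_div_iff₀ hx'] at h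
  rwa [inv_mul_eq_div, le_div_iff₀' hm]

theorem measurableSet_posSphere (N : Seminorm ℝ (Fin d → ℝ)) : MeasurableSet (posSphere N) :=
  measurableSet_Ici.inter (N.continuous_pi_real.measurable (measurableSet_singleton 1))

end Norm

/-! ### Scaling, null sets and the spectral measure -/

namespace IsRegVarying

variable {Ω : Type*} [MeasurableSpace Ω] {P : Measure Ω} {d : ℕ} {Z : Ω → Fin d → ℝ} {b : ℕ → ℝ}
  {ν : Measure (Fin d → ℝ)}

theorem sigmaFinite {α : ℝ} (hRV : IsRegVarying P α Z b ν) : SigmaFinite ν := by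
  refine ⟨⟨⟨fun n => {0} ∪ (Metric.ball 0 (1 / ((n : ℝ) + 1)))ᶜ, fun _ => trivial, fun n => ?_, ?_⟩⟩⟩
  · refine (measure_union_le _ _).trans_lt ?_
    rw [hRV.zero_null, zero_add]
    exact hRV.finite_away _ Metric.isOpen_ball.measurableSet.compl
      ⟨_, Nat.one_div_pos_of_nat, subset_rfl⟩
  · refine eq_univ_of_forall fun x => mem_iUnion.2 ?_
    rcases eq_or_ne x 0 with rfl | hx
    · exact ⟨0, by simp⟩
    · obtain ⟨n, hn⟩ := exists_nat_one_div_lt (norm_pos_iff.2 hx)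
      exact ⟨n, Or.inr (by simpa using hn.le)⟩

theorem ae_ne_zero {α : ℝ} (hRV : IsRegVarying P α Z b ν) : ∀ᵐ x ∂ν, x ≠ 0 := by
  simpa [ae_iff] using hRV.zero_null

theorem map_smul (hRV : IsRegVarying P 1 Z b ν) {s : ℝ} (hs : 0 < s) :
    ν.map (fun x => s • x) = ENNReal.ofReal s • ν := by
  ext B hB
  rw [Measure.map_apply (measurable_const_smul s) hB, preimage_smul₀ hs.ne',
    hRV.scaling _ (inv_pos.2 hs) _ hB, Real.rpow_neg_one, inv_inv, Measure.smul_apply, smul_eq_mul]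

theorem lintegral_comp_smul (hRV : IsRegVarying P 1 Z b ν) {s : ℝ} (hs : 0 < s)
    {f : (Fin d → ℝ) → ℝ≥0∞} (hf : Measurable f) :
    ∫⁻ x, f (s • x) ∂ν = ENNReal.ofReal s * ∫⁻ x, f x ∂ν := by
  rw [← smul_eq_mul, ← lintegral_smul_measure, ← hRV.map_smul hs,
    lintegral_map hf (measurable_const_smul s)]

theorem measure_level_set_eq_zero (hRV : IsRegVarying P 1 Z b ν) {g : (Fin d → ℝ) → ℝ}
    (hg : Measurable g) {κ : ℝ} (hκ : 0 < κ) (hom : ∀ t : ℝ, 0 < t → ∀ x, g (t • x) = t ^ κ * g x)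
    {s : ℝ} (hs : 0 < s) : ν {x | g x = s} = 0 := by
  by_contra hne
  have := hRV.sigmaFinite
  refine not_countable_Ioi_real 0 ?_
  refine (Measure.countable_meas_level_set_pos (μ := ν) hg).mono fun t (ht : 0 < t) => ?_
  rw [mem_ofPred_eq, pos_iff_ne_zero]
  refine fun h0 => hne ?_
  -- Dilation by this factor carries level `s` to level `t`.
  have hu : 0 < (t / s) ^ (1 / κ) := by positivity
  have hu' : ((t / s) ^ (1 / κ)) ^ κ = t / s := by
    rw [← Real.rpow_mul (by positivity), one_div_mul_cancel hκ.ne', Real.rpow_one]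
  have : {x | g x = s} = (fun x => ((t / s) ^ (1 / κ)) • x) ⁻¹' {x | g x = t} := by
    ext x
    simp only [mem_ofPred_eq, mem_preimage, hom _ hu, hu']
    field_simp
  have hm : MeasurableSet {x | g x = t} := hg (measurableSet_singleton t)
  rw [this, ← Measure.map_apply (measurable_const_smul _) hm,
    hRV.map_smul hu, Measure.smul_apply, h0, smul_zero]

/-- Each half-space `{-x i > ε}` is a continuity set, its boundary lying in a level set of a linear
form, and every prelimit probability vanishes there. -/
theorem ae_nonneg (hRV : IsRegVarying P 1 Z b ν) (hZ : ∀ᵐ ω ∂P, 0 ≤ Z ω) :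
    ∀ᵐ x ∂ν, 0 ≤ x := by
  have key : ∀ i, ∀ ε : ℝ, 0 < ε → ν {x | ε < -x i} = 0 := by
    intro i ε hε
    have hc : Continuous fun x : Fin d → ℝ => -x i := by fun_prop
    have hA : MeasurableSet {x : Fin d → ℝ | ε < -x i} := (isOpen_lt continuous_const hc).measurableSet
    refine tendsto_nhds_unique (hRV.tendsto _ hA ⟨ε, hε, fun x hx => ?_⟩ ?_) ?_
    · have h1 : ε < -x i := hx
      have h2 : |x i| ≤ ‖x‖ := norm_le_pi_norm x i
      have := neg_le_abs (x i)
      simp only [mem_compl_iff, mem_ball_zero_iff, not_lt]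
      linarith
    · refine measure_mono_null ((frontier_lt_subset_eq continuous_const hc).trans fun x hx => ?_)
        (hRV.measure_level_set_eq_zero hc.measurable one_pos (fun t _ x => by simp) hε)
      exact Eq.symm hx
    · refine tendsto_const_nhds.congr fun n => ?_
      have : P {ω | (b n)⁻¹ • Z ω ∈ {x : Fin d → ℝ | ε < -x i}} = 0 := by
        refine measure_eq_zero_iff_ae_notMem.2 (hZ.mono fun ω hω => ?_)
        have : 0 ≤ (b n)⁻¹ * Z ω i := mul_nonneg (inv_nonneg.2 (hRV.norm_nonneg n)) (hω i)
        simp only [mem_ofPred_eq, Pi.smul_apply, smul_eq_mul, not_lt]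
        linarith
      rw [this, mul_zero]
  simp only [Pi.le_def, ae_all_iff]
  intro i
  have : ∀ n : ℕ, ∀ᵐ x ∂ν, ¬ (1 / ((n : ℝ) + 1) < -x i) := fun n => by
    simpa only [ae_iff, not_not] using key i _ Nat.one_div_pos_of_nat
  filter_upwards [ae_all_iff.2 this] with x hx
  by_contra h
  obtain ⟨n, hn⟩ := exists_nat_one_div_lt (neg_pos.2 (not_le.1 h))
  exact hx n hn

variable (N : Seminorm ℝ (Fin d → ℝ))

theorem measure_lt_seminorm_lt_top (hRV : IsRegVarying P 1 Z b ν) {s : ℝ} (hs : 0 < s) :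
    ν {x | s < N x} < ∞ := by
  obtain ⟨K, hK, hNK⟩ := N.exists_le_mul_norm
  refine hRV.finite_away _ (isOpen_lt continuous_const N.continuous_pi_real).measurableSet
    ⟨s / K, by positivity, fun x (hx : s < N x) => ?_⟩
  simpa using (div_le_iff₀' hK).2 (hx.le.trans (hNK x))

theorem measure_one_lt_seminorm_pos (hRV : IsRegVarying P 1 Z b ν) (hN : ∀ x, N x = 0 → x = 0) :
    0 < ν {x | 1 < N x} := by
  refine pos_iff_ne_zero.2 fun h0 => hRV.ne_zero ?_
  have hm : MeasurableSet {x | 1 < N x} :=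
    (isOpen_lt continuous_const N.continuous_pi_real).measurableSet
  -- If `{N > 1}` were null, so would be all its dilates `{N > 1 / (n + 1)}`, which exhaust the
  -- complement of the origin.
  have h : ∀ n : ℕ, ν ((fun x => ((n : ℝ) + 1) • x) ⁻¹' {x | 1 < N x}) = 0 := fun n => by
    rw [← Measure.map_apply (measurable_const_smul _) hm, hRV.map_smul n.cast_add_one_pos,
      Measure.smul_apply, h0, smul_zero]
  rw [← ae_eq_bot, ← eventually_false_iff_eq_bot]
  filter_upwards [hRV.ae_ne_zero, ae_all_iff.2 fun n => measure_eq_zero_iff_ae_notMem.1 (h n)]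
    with x hx hn
  have hx' : 0 < N x := (apply_nonneg N x).lt_of_ne' fun h => hx (hN x h)
  obtain ⟨n, hn'⟩ := exists_nat_gt (N x)⁻¹
  refine hn n ?_
  have h1 : (N x)⁻¹ * N x = 1 := inv_mul_cancel₀ hx'.ne'
  have hn0 : (0 : ℝ) < n + 1 := n.cast_add_one_pos
  simp only [mem_preimage, mem_ofPred_eq, map_smul_eq_mul, Real.norm_of_nonneg hn0.le]
  nlinarith

theorem isProbabilityMeasure_spectralMeasure (hRV : IsRegVarying P 1 Z b ν)
    (hN : ∀ x, N x = 0 → x = 0) : IsProbabilityMeasure (spectralMeasure N ν) := by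
  refine ⟨?_⟩
  have hNm := N.continuous_pi_real.measurable
  rw [spectralMeasure, Measure.smul_apply, Measure.map_apply (by fun_prop) .univ, preimage_univ,
    Measure.restrict_apply_univ, smul_eq_mul, ENNReal.inv_mul_cancel
      (hRV.measure_one_lt_seminorm_pos N hN).ne' (hRV.measure_lt_seminorm_lt_top N one_pos).ne]

theorem spectralMeasure_compl_posSphere (hRV : IsRegVarying P 1 Z b ν) (hZ : ∀ᵐ ω ∂P, 0 ≤ Z ω) :
    spectralMeasure N ν (posSphere N)ᶜ = 0 := by
  have hNm := N.continuous_pi_real.measurable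
  have hm : MeasurableSet {x | 1 < N x} :=
    (isOpen_lt continuous_const N.continuous_pi_real).measurableSet
  rw [spectralMeasure, Measure.smul_apply, Measure.map_apply (by fun_prop)
    (measurableSet_posSphere N).compl, smul_eq_mul]
  refine mul_eq_zero_of_right _ (measure_eq_zero_iff_ae_notMem.2 ?_)
  filter_upwards [ae_restrict_mem hm, ae_restrict_of_ae (hRV.ae_nonneg hZ)] with x hx hx0
  have hx1 : 0 < N x := one_pos.trans hx
  simp only [mem_preimage, mem_compl_iff, not_not]
  refine ⟨smul_nonneg (inv_nonneg.2 hx1.le) hx0, ?_⟩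
  rw [map_smul_eq_mul, norm_inv, Real.norm_of_nonneg hx1.le, inv_mul_cancel₀ hx1.ne']

theorem restrict_spectralMeasure_posSphere (hRV : IsRegVarying P 1 Z b ν)
    (hZ : ∀ᵐ ω ∂P, 0 ≤ Z ω) :
    (spectralMeasure N ν).restrict (posSphere N) = spectralMeasure N ν :=
  Measure.restrict_eq_self_of_ae_mem <| by
    exact measure_eq_zero_iff_ae_notMem.1 (hRV.spectralMeasure_compl_posSphere N hZ) |>.mono
      fun _ => not_not.1

end IsRegVarying

/-! ### Polar decomposition -/

theorem lintegral_Ioi_zero_comp_mul_left {a : ℝ} (ha : 0 < a) {f : ℝ → ℝ≥0∞} (hf : Measurable f) :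
    ∫⁻ r in Ioi (0 : ℝ), f r = ENNReal.ofReal a * ∫⁻ r in Ioi (0 : ℝ), f (a * r) := by
  conv_lhs => rw [← Real.smul_map_volume_mul_left ha.ne']
  rw [Measure.restrict_smul, lintegral_smul_measure,
    setLIntegral_map measurableSet_Ioi hf (measurable_const_mul a), preimage_const_mul_Ioi₀ _ ha,
    zero_div, abs_of_pos ha, smul_eq_mul]

theorem lintegral_Ioi_rpow_neg_two {a : ℝ} (ha : 0 < a) :
    ∫⁻ r in Ioi a, ENNReal.ofReal (r ^ (-2 : ℝ)) = ENNReal.ofReal a⁻¹ := by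
  rw [← ofReal_integral_eq_lintegral_ofReal (integrableOn_Ioi_rpow_of_lt (by norm_num) ha),
    integral_Ioi_rpow_of_lt (by norm_num) ha]
  · norm_num [Real.rpow_neg_one]
  · filter_upwards [ae_restrict_mem measurableSet_Ioi] with r hr
    exact Real.rpow_nonneg (ha.trans hr).le _

namespace IsRegVarying

variable {Ω : Type*} [MeasurableSpace Ω] {P : Measure Ω} {d : ℕ} {Z : Ω → Fin d → ℝ} {b : ℕ → ℝ}
  {ν : Measure (Fin d → ℝ)}

theorem lintegral_spectralMeasure (N : Seminorm ℝ (Fin d → ℝ)) (hRV : IsRegVarying P 1 Z b ν)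
    (hN : ∀ x, N x = 0 → x = 0) (hZ : ∀ᵐ ω ∂P, 0 ≤ Z ω) {f : (Fin d → ℝ) → ℝ≥0∞}
    (hf : Measurable f) :
    ν {x | 1 < N x} * ∫⁻ u in posSphere N, f u ∂(spectralMeasure N ν) =
      ∫⁻ x in {x | 1 < N x}, f ((N x)⁻¹ • x) ∂ν := by
  have hNm := N.continuous_pi_real.measurable
  rw [hRV.restrict_spectralMeasure_posSphere N hZ, spectralMeasure, lintegral_smul_measure,
    lintegral_map hf (by fun_prop), smul_eq_mul, ← mul_assoc,
    ENNReal.mul_inv_cancel (hRV.measure_one_lt_seminorm_pos N hN).ne'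
      (hRV.measure_lt_seminorm_lt_top N one_pos).ne, one_mul]

theorem measure_eq_lintegral_polar (N : Seminorm ℝ (Fin d → ℝ)) (hRV : IsRegVarying P 1 Z b ν)
    (hN : ∀ x, N x = 0 → x = 0) (hZ : ∀ᵐ ω ∂P, 0 ≤ Z ω) {A : Set (Fin d → ℝ)}
    (hA : MeasurableSet A) :
    ν A = ν {x | 1 < N x} *
      ∫⁻ u in posSphere N, (∫⁻ r in Ioi (0 : ℝ),
        A.indicator (fun _ => 1) (r • u) * ENNReal.ofReal (r ^ (-2 : ℝ)))
        ∂(spectralMeasure N ν) := by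
  have := hRV.sigmaFinite
  have hNm := N.continuous_pi_real.measurable
  have hm : MeasurableSet {x | 1 < N x} :=
    (isOpen_lt continuous_const N.continuous_pi_real).measurableSet
  have hI : Measurable (A.indicator fun _ => (1 : ℝ≥0∞)) := measurable_const.indicator hA
  have hF : Measurable fun p : (Fin d → ℝ) × ℝ =>
      A.indicator (fun _ => (1 : ℝ≥0∞)) (p.2 • p.1) * ENNReal.ofReal (p.2 ^ (-2 : ℝ)) := by
    have : Measurable fun p : (Fin d → ℝ) × ℝ => p.2 • p.1 := by fun_prop
    exact (hI.comp this).mul (by fun_prop)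
  -- the restriction to `N > 1`, with the change of variables `r = N x * s`, is integrated by Tonelli
  set F : (Fin d → ℝ) → ℝ → ℝ≥0∞ := fun y s =>
    {y | s < N y}.indicator 1 y * A.indicator (fun _ => 1) y * ENNReal.ofReal (N y)⁻¹ with hFdef
  have hFm : Measurable (Function.uncurry F) := by
    have h1 : Measurable fun p : (Fin d → ℝ) × ℝ => {y | p.2 < N y}.indicator (1 : (Fin d → ℝ) → ℝ≥0∞) p.1 := by
      have : MeasurableSet {p : (Fin d → ℝ) × ℝ | p.2 < N p.1} :=
        measurableSet_lt measurable_snd (hNm.comp measurable_fst)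
      exact Measurable.indicator (f := fun _ => (1 : ℝ≥0∞)) measurable_const this
    refine (h1.mul (hI.comp measurable_fst)).mul ?_
    fun_prop
  -- Substitute `y = s • x`: scaling of `ν` contributes one factor `s⁻¹`, and `(N y)⁻¹` the other,
  -- which together give `s⁻²`.
  have hslice : ∀ s : ℝ, 0 < s →
      ∫⁻ x in {x | 1 < N x}, ENNReal.ofReal (N x)⁻¹ *
        (A.indicator (fun _ => 1) (s • x) * ENNReal.ofReal (s ^ (-2 : ℝ))) ∂ν =
      ∫⁻ y, F y s ∂ν := by
    intro s hs
    have hFs : Measurable fun y => F y s := hFm.comp (measurable_id.prodMk measurable_const)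
    have h1 : ∫⁻ y, F y s ∂ν = ENNReal.ofReal s⁻¹ * ∫⁻ x, F (s • x) s ∂ν := by
      rw [hRV.lintegral_comp_smul hs hFs, ← mul_assoc, ← ENNReal.ofReal_mul (inv_nonneg.2 hs.le),
        inv_mul_cancel₀ hs.ne', ENNReal.ofReal_one, one_mul]
    have h2 : Measurable fun x => F (s • x) s := hFs.comp (measurable_const_smul s)
    rw [h1, ← lintegral_const_mul _ h2, ← lintegral_indicator hm]
    refine lintegral_congr fun x => ?_
    have hiff : s < N (s • x) ↔ 1 < N x := by
      rw [map_smul_eq_mul, Real.norm_of_nonneg hs.le]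
      exact lt_mul_iff_one_lt_right hs
    by_cases hx : 1 < N x
    · have hx' := hiff.2 hx
      simp only [hFdef, indicator, mem_ofPred_eq, hx, hx', if_true, Pi.one_apply, one_mul]
      by_cases hsA : s • x ∈ A
      · simp only [hsA, if_true, one_mul]
        rw [← ENNReal.ofReal_mul (by positivity), ← ENNReal.ofReal_mul (by positivity),
          map_smul_eq_mul, Real.norm_of_nonneg hs.le, Real.rpow_neg hs.le, Real.rpow_two]
        congr 1
        field_simp
      · simp [hsA]
    · have hx' := hiff.not.2 hx
      simp [hFdef, indicator, hx, hx']
  symm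
  rw [hRV.lintegral_spectralMeasure N hN hZ hF.lintegral_prod_right']
  calc _ = ∫⁻ x in {x | 1 < N x}, (∫⁻ s in Ioi (0 : ℝ), ENNReal.ofReal (N x)⁻¹ *
        (A.indicator (fun _ => 1) (s • x) * ENNReal.ofReal (s ^ (-2 : ℝ)))) ∂ν := by
        refine setLIntegral_congr_fun hm fun x hx => ?_
        have hx0 : 0 < N x := one_pos.trans hx
        have hFx : ∀ y : Fin d → ℝ, Measurable fun r : ℝ =>
            A.indicator (fun _ => (1 : ℝ≥0∞)) (r • y) * ENNReal.ofReal (r ^ (-2 : ℝ)) :=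
          fun y => hF.comp measurable_prodMk_left
        dsimp only
        rw [lintegral_Ioi_zero_comp_mul_left hx0 (hFx _), ← lintegral_const_mul' _ _ ENNReal.ofReal_ne_top]
        refine setLIntegral_congr_fun measurableSet_Ioi fun s (hs : 0 < s) => ?_
        have h1 : (N x * s) • (N x)⁻¹ • x = s • x := by
          rw [smul_smul, mul_right_comm, mul_inv_cancel₀ hx0.ne', one_mul]
        rw [h1, mul_left_comm, mul_left_comm (ENNReal.ofReal (N x)⁻¹),
          ← ENNReal.ofReal_mul hx0.le, ← ENNReal.ofReal_mul (by positivity),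
          Real.mul_rpow hx0.le hs.le, Real.rpow_neg hx0.le, Real.rpow_two]
        congr 2
        field_simp
    _ = ∫⁻ s in Ioi (0 : ℝ), ∫⁻ x in {x | 1 < N x}, ENNReal.ofReal (N x)⁻¹ *
        (A.indicator (fun _ => 1) (s • x) * ENNReal.ofReal (s ^ (-2 : ℝ))) ∂ν := by
        refine lintegral_lintegral_swap (Measurable.aemeasurable ?_)
        exact (ENNReal.measurable_ofReal.comp (hNm.comp measurable_fst).inv).mul hF
    _ = ∫⁻ s in Ioi (0 : ℝ), ∫⁻ y, F y s ∂ν :=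
        setLIntegral_congr_fun measurableSet_Ioi fun s hs => hslice s hs
    _ = ∫⁻ y, (∫⁻ s in Ioi (0 : ℝ), F y s) ∂ν := (lintegral_lintegral_swap hFm.aemeasurable).symm
    _ = ∫⁻ y, A.indicator (fun _ => 1) y ∂ν := by
        -- The `s`-integral runs over `(0, N y)`; its length cancels `(N y)⁻¹` off the origin.
        refine lintegral_congr_ae (hRV.ae_ne_zero.mono fun y hy => ?_)
        have hy0 : 0 < N y := (apply_nonneg N y).lt_of_ne' fun h => hy (hN y h)
        have h1 : ∀ s, F y s = (Iio (N y)).indicator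
            (fun _ => A.indicator (fun _ => 1) y * ENNReal.ofReal (N y)⁻¹) s := fun s => by
          by_cases hs : s < N y <;> simp [hFdef, indicator, hs]
        simp only [h1]
        rw [lintegral_indicator measurableSet_Iio, lintegral_const, Measure.restrict_restrict
          measurableSet_Iio, Measure.restrict_apply_univ, Iio_inter_Ioi, Real.volume_Ioo, sub_zero,
          mul_assoc, ← ENNReal.ofReal_mul (by positivity), inv_mul_cancel₀ hy0.ne',
          ENNReal.ofReal_one, mul_one]
    _ = ν A := by rw [lintegral_indicator hA, setLIntegral_one]

end IsRegVarying

/-! ### Homogeneous functions on the orthant -/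

/-- The canonical extension of `h : [0, ∞)^d → ℝ` to `ℝ^d`, constant along the projection onto the
orthant. -/
def extendNonneg {d : ℕ} (h : (Fin d → ℝ) → ℝ) (x : Fin d → ℝ) : ℝ := h (x ⊔ 0)

section extendNonneg

variable {d : ℕ} {h : (Fin d → ℝ) → ℝ}

theorem extendNonneg_of_nonneg {x : Fin d → ℝ} (hx : 0 ≤ x) : extendNonneg h x = h x := by
  rw [extendNonneg, sup_of_le_left hx]

theorem continuous_sup_zero : Continuous fun x : Fin d → ℝ => x ⊔ 0 :=
  continuous_pi fun i => (continuous_apply i).max continuous_const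

theorem measurable_extendNonneg (hh : Measurable fun x : Ici (0 : Fin d → ℝ) => h x) :
    Measurable (extendNonneg h) := by
  have : Measurable fun x : Fin d → ℝ => (⟨x ⊔ 0, mem_Ici.2 le_sup_right⟩ : Ici (0 : Fin d → ℝ)) :=
    continuous_sup_zero.measurable.subtype_mk
  exact hh.comp this

theorem extendNonneg_smul {ξ : ℝ} (hom : ∀ t : ℝ, 0 < t → ∀ x, 0 ≤ x → h (t • x) = t ^ ξ * h x)
    {t : ℝ} (ht : 0 < t) (x : Fin d → ℝ) : extendNonneg h (t • x) = t ^ ξ * extendNonneg h x := by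
  have : t • x ⊔ 0 = t • (x ⊔ 0) := by
    ext i
    simp [mul_max_of_nonneg _ _ ht.le]
  rw [extendNonneg, this, hom t ht _ le_sup_right, extendNonneg]

/-- Frontiers are taken in `ℝ^d`, so continuity relative to the orthant must become full continuity;
`y ↦ y ⊔ 0` retracts onto the orthant. -/
theorem continuousAt_extendNonneg {x : Fin d → ℝ} (hx : 0 ≤ x)
    (hc : ContinuousWithinAt h (Ici 0) x) : ContinuousAt (extendNonneg h) x := by
  have h1 : Tendsto (fun y : Fin d → ℝ => y ⊔ 0) (𝓝 x) (𝓝[Ici 0] x) := by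
    refine tendsto_nhdsWithin_iff.2 ⟨?_, .of_forall fun y => mem_Ici.2 le_sup_right⟩
    simpa only [sup_of_le_left hx] using (continuous_sup_zero (d := d)).tendsto x
  rw [ContinuousAt, extendNonneg_of_nonneg hx]
  exact hc.tendsto.comp h1

theorem exists_extendNonneg_le (N : Seminorm ℝ (Fin d → ℝ)) (hN : ∀ x, N x = 0 → x = 0) {ξ : ℝ}
    (hξ : 0 < ξ) (hom : ∀ t : ℝ, 0 < t → ∀ x, 0 ≤ x → h (t • x) = t ^ ξ * h x) {M : ℝ}
    (hM : ∀ u ∈ posSphere N, h u ≤ M) : ∃ C > 0, ∀ x, extendNonneg h x ≤ C * ‖x‖ ^ ξ := by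
  obtain ⟨K, hK, hNK⟩ := N.exists_le_mul_norm
  refine ⟨max M 1 * K ^ ξ, by positivity, fun x => ?_⟩
  have hM0 : 0 < max M 1 := lt_max_of_lt_right one_pos
  set y := x ⊔ 0 with hy
  have hy0 : 0 ≤ y := le_sup_right
  have hyx : ‖y‖ ≤ ‖x‖ := by
    refine (pi_norm_le_iff_of_nonneg (norm_nonneg x)).2 fun i => ?_
    have h1 : |x i| ≤ ‖x‖ := norm_le_pi_norm x i
    rw [Real.norm_of_nonneg (hy0 i)]
    exact max_le ((le_abs_self _).trans h1) (norm_nonneg x)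
  change h y ≤ _
  rcases eq_or_ne y 0 with h0 | h0
  -- The origin cannot be normalised to the sphere; homogeneity alone forces `h 0 = 0`.
  · have h2 : h 0 = 2 ^ ξ * h 0 := by simpa using hom 2 two_pos 0 le_rfl
    have h3 : (1 : ℝ) < 2 ^ ξ := Real.one_lt_rpow one_lt_two hξ
    have h4 : h 0 = 0 := by
      have : (2 ^ ξ - 1) * h 0 = 0 := by linarith
      exact (mul_eq_zero.1 this).resolve_left (by linarith)
    rw [h0, h4]
    positivity
  · have hNy : 0 < N y := (apply_nonneg N y).lt_of_ne' fun h => h0 (hN y h)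
    have hu : (N y)⁻¹ • y ∈ posSphere N := by
      refine ⟨smul_nonneg (inv_nonneg.2 hNy.le) hy0, ?_⟩
      rw [map_smul_eq_mul, norm_inv, Real.norm_of_nonneg hNy.le, inv_mul_cancel₀ hNy.ne']
    have h1 : h y = N y ^ ξ * h ((N y)⁻¹ • y) := by
      rw [← hom _ hNy _ hu.1, smul_inv_smul₀ hNy.ne']
    calc h y ≤ N y ^ ξ * max M 1 := by
          rw [h1]
          gcongr
          exact (hM _ hu).trans (le_max_left _ _)
      _ ≤ (K * ‖x‖) ^ ξ * max M 1 := by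
          gcongr
          exact (hNK y).trans (by gcongr)
      _ = max M 1 * K ^ ξ * ‖x‖ ^ ξ := by rw [Real.mul_rpow hK.le (norm_nonneg x)]; ring

end extendNonneg

theorem frontier_setOf_lt_subset_of_continuousAt {E : Type*} [TopologicalSpace E] {g : E → ℝ}
    {s : ℝ} {x : E} (hg : ContinuousAt g x) (hx : x ∈ frontier {x | s < g x}) : g x = s := by
  rcases lt_trichotomy (g x) s with h | h | h
  · have h1 := mem_closure_iff_frequently.1 hx.1
    obtain ⟨y, hy, hys⟩ := (h1.and_eventually (hg.eventually_lt_const h)).exists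
    exact absurd hys (not_lt.2 (le_of_lt hy))
  · exact h
  · exact absurd (mem_interior_iff_mem_nhds.2 (hg.eventually_const_lt h)) hx.2

theorem exists_setOf_lt_subset_compl_ball {E : Type*} [SeminormedAddCommGroup E] {g : E → ℝ}
    {C ξ s : ℝ} (hC : 0 < C) (hξ : 0 < ξ) (hg : ∀ x, g x ≤ C * ‖x‖ ^ ξ) (hs : 0 < s) :
    ∃ ε > 0, {x | s < g x} ⊆ (Metric.ball 0 ε)ᶜ := by
  refine ⟨(s / C) ^ (1 / ξ), by positivity, fun x (hx : s < g x) => ?_⟩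
  rw [mem_compl_iff, mem_ball_zero_iff, not_lt]
  have h1 : s / C ≤ ‖x‖ ^ ξ := (div_le_iff₀' hC).2 (hx.le.trans (hg x))
  calc (s / C) ^ (1 / ξ) ≤ (‖x‖ ^ ξ) ^ (1 / ξ) := by gcongr
    _ = ‖x‖ := by rw [← Real.rpow_mul (norm_nonneg x), mul_one_div_cancel hξ.ne', Real.rpow_one]

theorem lintegral_indicator_lt_rpow_mul {ξ s a : ℝ} (hξ : 0 < ξ) (hs : 0 < s) (ha : 0 ≤ a) :
    ∫⁻ r in Ioi (0 : ℝ), {r | s < r ^ ξ * a}.indicator (fun _ => 1) r *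
      ENNReal.ofReal (r ^ (-2 : ℝ)) = ENNReal.ofReal ((a / s) ^ (1 / ξ)) := by
  rcases ha.eq_or_lt with rfl | ha
  · have : ¬ s < 0 := hs.not_gt
    simp [this, hξ.ne']
  have h0 : 0 < (s / a) ^ (1 / ξ) := by positivity
  have hiff : ∀ r ∈ Ioi (0 : ℝ), {r | s < r ^ ξ * a}.indicator (fun _ => 1) r *
      ENNReal.ofReal (r ^ (-2 : ℝ)) =
      (Ioi ((s / a) ^ (1 / ξ))).indicator (fun r => ENNReal.ofReal (r ^ (-2 : ℝ))) r := by
    intro r hr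
    have : s < r ^ ξ * a ↔ (s / a) ^ (1 / ξ) < r := by
      rw [← div_lt_iff₀ ha, one_div, Real.rpow_inv_lt_iff_of_pos (by positivity) (le_of_lt hr) hξ]
    by_cases h : s < r ^ ξ * a
    · simp only [indicator, mem_ofPred_eq, h, if_true, mem_Ioi, this.1 h, one_mul]
    · simp only [indicator, mem_ofPred_eq, h, if_false, mem_Ioi, this.not.1 h, zero_mul]
  rw [setLIntegral_congr_fun measurableSet_Ioi hiff, lintegral_indicator measurableSet_Ioi,
    Measure.restrict_restrict measurableSet_Ioi, Ioi_inter_Ioi, sup_of_le_left h0.le,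
    lintegral_Ioi_rpow_neg_two h0, ← Real.inv_rpow (by positivity), inv_div]

/-! ### Tails of homogeneous functionals -/

namespace IsRegVarying

variable {Ω : Type*} [MeasurableSpace Ω] {P : Measure Ω} {d : ℕ} {Z : Ω → Fin d → ℝ} {b : ℕ → ℝ}
  {ν : Measure (Fin d → ℝ)} {g : (Fin d → ℝ) → ℝ} {ξ : ℝ}

theorem tendsto_measureReal_homogeneous (hRV : IsRegVarying P 1 Z b ν) (hξ : 0 < ξ)
    (hg : Measurable g) (hom : ∀ t : ℝ, 0 < t → ∀ x, g (t • x) = t ^ ξ * g x) {C : ℝ} (hC : 0 < C)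
    (hgC : ∀ x, g x ≤ C * ‖x‖ ^ ξ) (hc : ∀ᵐ x ∂ν, ContinuousAt g x) {s : ℝ} (hs : 0 < s) :
    Tendsto (fun n : ℕ => (n : ℝ) * P.real {ω | s < b n ^ (-ξ) * g (Z ω)}) atTop
      (𝓝 (ν.real {x | s < g x})) := by
  have hA : MeasurableSet {x | s < g x} := measurableSet_lt measurable_const hg
  have haway := exists_setOf_lt_subset_compl_ball hC hξ hgC hs
  have hfr : ν (frontier {x | s < g x}) = 0 := by
    have h1 : ∀ᵐ x ∂ν, g x ≠ s := by
      simpa [ae_iff] using hRV.measure_level_set_eq_zero hg hξ hom hs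
    refine measure_eq_zero_iff_ae_notMem.2 ?_
    filter_upwards [hc, h1] with x hx h1x hfr
    exact h1x (frontier_setOf_lt_subset_of_continuousAt hx hfr)
  have h := (ENNReal.tendsto_toReal (hRV.finite_away _ hA haway).ne).comp
    (hRV.tendsto _ hA haway hfr)
  refine h.congr' ?_
  -- Early `b n` may be zero, and homogeneity needs a positive factor.
  filter_upwards [hRV.norm_tendsto.eventually_gt_atTop 0] with n hn
  have : {ω | s < g ((b n)⁻¹ • Z ω)} = {ω | s < b n ^ (-ξ) * g (Z ω)} := by
    ext ω
    simp only [mem_ofPred_eq, hom _ (inv_pos.2 hn), Real.inv_rpow hn.le, Real.rpow_neg hn.le]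
  simp only [Function.comp_apply]
  rw [this, ENNReal.toReal_mul, ENNReal.toReal_natCast, measureReal_def]

theorem measure_homogeneous_gt (hRV : IsRegVarying P 1 Z b ν) (N : Seminorm ℝ (Fin d → ℝ))
    (hN : ∀ x, N x = 0 → x = 0) (hZ : ∀ᵐ ω ∂P, 0 ≤ Z ω) (hξ : 0 < ξ) (hg : Measurable g)
    (hg0 : ∀ x, 0 ≤ g x) (hom : ∀ t : ℝ, 0 < t → ∀ x, g (t • x) = t ^ ξ * g x) {s : ℝ}
    (hs : 0 < s) :
    ν {x | s < g x} = ν {x | 1 < N x} *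
      ∫⁻ u in posSphere N, ENNReal.ofReal ((g u / s) ^ (1 / ξ)) ∂(spectralMeasure N ν) := by
  have hA : MeasurableSet {x | s < g x} := measurableSet_lt measurable_const hg
  rw [hRV.measure_eq_lintegral_polar N hN hZ hA]
  congr 1
  refine lintegral_congr fun u => ?_
  rw [← lintegral_indicator_lt_rpow_mul hξ hs (hg0 u)]
  refine setLIntegral_congr_fun measurableSet_Ioi fun r (hr : 0 < r) => ?_
  simp only [indicator, mem_ofPred_eq, hom r hr]

theorem integrableOn_homogeneous_rpow (hRV : IsRegVarying P 1 Z b ν) (N : Seminorm ℝ (Fin d → ℝ))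
    (hN : ∀ x, N x = 0 → x = 0) (hξ : 0 < ξ) (hg : Measurable g) (hg0 : ∀ x, 0 ≤ g x) {C : ℝ}
    (hC : 0 < C) (hgC : ∀ x, g x ≤ C * ‖x‖ ^ ξ) :
    IntegrableOn (fun u => g u ^ (1 / ξ)) (posSphere N) (spectralMeasure N ν) := by
  have := hRV.isProbabilityMeasure_spectralMeasure N hN
  obtain ⟨k, hk, hNk⟩ := N.exists_norm_le_mul hN
  refine IntegrableOn.of_bound (measure_lt_top _ _)
    (hg.pow_const _).aestronglyMeasurable ((C * k ^ ξ) ^ (1 / ξ)) ?_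
  filter_upwards [ae_restrict_mem (measurableSet_posSphere N)] with u hu
  rw [Real.norm_of_nonneg (Real.rpow_nonneg (hg0 u) _)]
  have h1 : ‖u‖ ≤ k := by simpa [hu.2] using hNk u
  have := hg0 u
  gcongr
  exact (hgC u).trans (by gcongr)

theorem measureReal_homogeneous_gt (hRV : IsRegVarying P 1 Z b ν) (N : Seminorm ℝ (Fin d → ℝ))
    (hN : ∀ x, N x = 0 → x = 0) (hZ : ∀ᵐ ω ∂P, 0 ≤ Z ω) (hξ : 0 < ξ) (hg : Measurable g)
    (hg0 : ∀ x, 0 ≤ g x) (hom : ∀ t : ℝ, 0 < t → ∀ x, g (t • x) = t ^ ξ * g x) {s : ℝ}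
    (hs : 0 < s) :
    ν.real {x | s < g x} = ν.real {x | 1 < N x} *
      (∫ u in posSphere N, g u ^ (1 / ξ) ∂(spectralMeasure N ν)) * s ^ (-(1 / ξ)) := by
  rw [measureReal_def, hRV.measure_homogeneous_gt N hN hZ hξ hg hg0 hom hs, ENNReal.toReal_mul,
    ← integral_eq_lintegral_of_nonneg_ae
      (.of_forall fun u => Real.rpow_nonneg (div_nonneg (hg0 u) hs.le) _)
      ((hg.div_const s).pow_const _).aestronglyMeasurable, mul_assoc, ← integral_mul_const]
  congr 2
  ext u
  rw [Real.div_rpow (hg0 u) hs.le, Real.rpow_neg hs.le, div_eq_mul_inv]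

theorem tendsto_risk_functional (hRV : IsRegVarying P 1 Z b ν) (N : Seminorm ℝ (Fin d → ℝ))
    (hN : ∀ x, N x = 0 → x = 0) (hZ : ∀ᵐ ω ∂P, 0 ≤ Z ω) (hξ : 0 < ξ) {h : (Fin d → ℝ) → ℝ}
    (hm : Measurable fun x : Ici (0 : Fin d → ℝ) => h x) (h0 : ∀ x, 0 ≤ x → 0 ≤ h x)
    (hom : ∀ t : ℝ, 0 < t → ∀ x, 0 ≤ x → h (t • x) = t ^ ξ * h x)
    (hM : ∃ M : ℝ, ∀ u ∈ posSphere N, h u ≤ M)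
    (hc : ∀ᵐ x ∂ν, ContinuousWithinAt h (Ici 0) x) :
    IntegrableOn (fun u => h u ^ (1 / ξ)) (posSphere N) (spectralMeasure N ν) ∧
      ∀ s : ℝ, 0 < s →
        Tendsto (fun n : ℕ => (n : ℝ) * P.real {ω | s < b n ^ (-ξ) * h (Z ω)}) atTop
          (𝓝 (ν.real {x | 1 < N x} *
            (∫ u in posSphere N, h u ^ (1 / ξ) ∂(spectralMeasure N ν)) * s ^ (-(1 / ξ)))) := by
  obtain ⟨M, hM⟩ := hM
  obtain ⟨C, hC, hgC⟩ := exists_extendNonneg_le N hN hξ hom hM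
  have hg := measurable_extendNonneg hm
  have hg0 : ∀ x, 0 ≤ extendNonneg h x := fun x => h0 _ le_sup_right
  have hgom : ∀ t : ℝ, 0 < t → ∀ x, extendNonneg h (t • x) = t ^ ξ * extendNonneg h x :=
    fun t ht x => extendNonneg_smul hom ht x
  have hEq : EqOn (fun u => extendNonneg h u ^ (1 / ξ)) (fun u => h u ^ (1 / ξ)) (posSphere N) :=
    fun u hu => by simp only [extendNonneg_of_nonneg hu.1]
  have hS := measurableSet_posSphere N
  refine ⟨(hRV.integrableOn_homogeneous_rpow N hN hξ hg hg0 hC hgC).congr_fun hEq hS,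
    fun s hs => ?_⟩
  have hgc : ∀ᵐ x ∂ν, ContinuousAt (extendNonneg h) x := by
    filter_upwards [hc, hRV.ae_nonneg hZ] with x hx hx0 using continuousAt_extendNonneg hx0 hx
  have key := hRV.tendsto_measureReal_homogeneous hξ hg hgom hC hgC hgc hs
  rw [hRV.measureReal_homogeneous_gt N hN hZ hξ hg hg0 hgom hs, setIntegral_congr_fun hS hEq] at key
  refine key.congr fun n => ?_
  congr 1
  refine measureReal_congr (hZ.mono fun ω hω => propext ?_)
  change s < b n ^ (-ξ) * extendNonneg h (Z ω) ↔ s < b n ^ (-ξ) * h (Z ω)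
  rw [extendNonneg_of_nonneg hω]

end IsRegVarying

/-! ### From thresholds along a sequence to real thresholds -/

theorem exists_tendsto_nat_between {a : ℕ → ℝ} (ha : Monotone a) (hat : Tendsto a atTop atTop) :
    ∃ m : ℝ → ℕ, Tendsto m atTop atTop ∧ ∀ᶠ x in atTop, a (m x) ≤ x ∧ x ≤ a (m x + 1) := by
  have hex : ∀ x, ∃ n, x < a n := fun x => (hat.eventually_gt_atTop x).exists
  have hlt : ∀ k x, a k ≤ x → k < Nat.find (hex x) := fun k x hx =>
    lt_of_not_ge fun h => absurd (Nat.find_spec (hex x)) (not_lt.2 ((ha h).trans hx))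
  -- The index just before the first term exceeding `x`; for `x ≥ a 0` the subtraction does not
  -- truncate.
  refine ⟨fun x => Nat.find (hex x) - 1, tendsto_atTop.2 fun k => ?_, ?_⟩
  · filter_upwards [eventually_ge_atTop (a k)] with x hx
    exact Nat.le_sub_one_of_lt (hlt k x hx)
  · filter_upwards [eventually_ge_atTop (a 0)] with x hx
    have h0 := hlt 0 x hx
    refine ⟨not_lt.1 (Nat.find_min (hex x) (Nat.sub_one_lt h0.ne')), ?_⟩
    rw [Nat.sub_one_add_one h0.ne']
    exact (Nat.find_spec (hex x)).le

/-- Squeeze `F x` between its values at the neighbouring terms; the index shift is harmless since `n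
/ (n + 1) → 1`. -/
theorem Antitone.tendsto_natCast_mul_of_between {F : ℝ → ℝ} (hF : Antitone F) {a : ℕ → ℝ}
    {A : ℝ} (hA : Tendsto (fun n : ℕ => (n : ℝ) * F (a n)) atTop (𝓝 A)) {m : ℝ → ℕ}
    (hm : Tendsto m atTop atTop) (hma : ∀ᶠ x in atTop, a (m x) ≤ x ∧ x ≤ a (m x + 1)) :
    Tendsto (fun x => (m x : ℝ) * F x) atTop (𝓝 A) := by
  have h1 : Tendsto (fun n : ℕ => (n : ℝ) * F (a (n + 1))) atTop (𝓝 A) := by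
    have h2 := (tendsto_natCast_div_add_atTop (1 : ℝ)).mul (hA.comp (tendsto_add_atTop_nat 1))
    rw [one_mul] at h2
    refine h2.congr fun n => ?_
    have : (n : ℝ) + 1 ≠ 0 := n.cast_add_one_ne_zero
    simp only [Function.comp_apply, Nat.cast_add, Nat.cast_one]
    field_simp
  refine tendsto_of_tendsto_of_tendsto_of_le_of_le' (h1.comp hm) (hA.comp hm) ?_ ?_
  · filter_upwards [hma] with x hx
    exact mul_le_mul_of_nonneg_left (hF hx.2) (Nat.cast_nonneg _)
  · filter_upwards [hma] with x hx
    exact mul_le_mul_of_nonneg_left (hF hx.1) (Nat.cast_nonneg _)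

theorem Antitone.tendsto_div_of_tendsto_natCast_mul {F G : ℝ → ℝ} (hF : Antitone F)
    (hG : Antitone G) {a : ℕ → ℝ} (ha : Monotone a) (hat : Tendsto a atTop atTop) {A B : ℝ}
    (hA : Tendsto (fun n : ℕ => (n : ℝ) * F (a n)) atTop (𝓝 A))
    (hB : Tendsto (fun n : ℕ => (n : ℝ) * G (a n)) atTop (𝓝 B)) (hB0 : B ≠ 0) :
    Tendsto (fun x => F x / G x) atTop (𝓝 (A / B)) := by
  obtain ⟨m, hm, hma⟩ := exists_tendsto_nat_between ha hat
  refine ((hF.tendsto_natCast_mul_of_between hA hm hma).div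
    (hG.tendsto_natCast_mul_of_between hB hm hma) hB0).congr' ?_
  filter_upwards [hm.eventually_ge_atTop 1] with x hx
  exact mul_div_mul_left _ _ (by positivity)

theorem antitone_measureReal_lt {Ω : Type*} [MeasurableSpace Ω] (P : Measure Ω) [IsFiniteMeasure P]
    (Y : Ω → ℝ) : Antitone fun x => P.real {ω | x < Y ω} :=
  fun _ _ hxy => measureReal_mono fun _ hω => hxy.trans_lt hω

/-! ### Portfolios -/

namespace IsRegVarying

variable {Ω : Type*} [MeasurableSpace Ω] {P : Measure Ω} {d : ℕ} {Z : Ω → Fin d → ℝ} {b : ℕ → ℝ}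
  {ν : Measure (Fin d → ℝ)} {ξ : ℝ}

theorem monotone_norm_rpow (hRV : IsRegVarying P 1 Z b ν) (hξ : 0 < ξ) :
    Monotone fun n => b n ^ ξ :=
  fun _ _ h => Real.rpow_le_rpow (hRV.norm_nonneg _) (hRV.norm_mono h) hξ.le

theorem tendsto_norm_rpow (hRV : IsRegVarying P 1 Z b ν) (hξ : 0 < ξ) :
    Tendsto (fun n => b n ^ ξ) atTop atTop :=
  (tendsto_rpow_atTop hξ).comp hRV.norm_tendsto

theorem tendsto_portfolio (hRV : IsRegVarying P 1 Z b ν) (N : Seminorm ℝ (Fin d → ℝ))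
    (hN : ∀ x, N x = 0 → x = 0) (hξ : 0 < ξ) {X : Ω → Fin d → ℝ}
    (hX0 : ∀ᵐ ω ∂P, ∀ i, 0 ≤ X ω i) (hZ : ∀ ω i, Z ω i = X ω i ^ (1 / ξ)) {w : Fin d → ℝ}
    (hw : ∀ i, 0 ≤ w i) :
    IntegrableOn (fun u => (∑ i, w i * u i ^ ξ) ^ (1 / ξ)) (posSphere N) (spectralMeasure N ν) ∧
      Tendsto (fun n : ℕ => (n : ℝ) * P.real {ω | b n ^ ξ < ∑ i, w i * X ω i}) atTop
        (𝓝 (ν.real {x | 1 < N x} *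
          ∫ u in posSphere N, (∑ i, w i * u i ^ ξ) ^ (1 / ξ) ∂(spectralMeasure N ν))) := by
  have hZ0 : ∀ᵐ ω ∂P, 0 ≤ Z ω := hX0.mono fun ω hω i => by
    rw [hZ]
    exact Real.rpow_nonneg (hω i) _
  have hcont : Continuous fun x : Fin d → ℝ => ∑ i, w i * x i ^ ξ := by
    fun_prop (disch := exact hξ.le)
  obtain ⟨k, hk, hNk⟩ := N.exists_norm_le_mul hN
  obtain ⟨hint, hlim⟩ := hRV.tendsto_risk_functional N hN hZ0 hξ
    (h := fun x => ∑ i, w i * x i ^ ξ) (hcont.measurable.comp measurable_subtype_coe)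
    (fun x hx => Finset.sum_nonneg fun i _ => mul_nonneg (hw i) (Real.rpow_nonneg (hx i) _))
    (fun t ht x hx => by
      rw [Finset.mul_sum]
      refine Finset.sum_congr rfl fun i _ => ?_
      rw [Pi.smul_apply, smul_eq_mul, Real.mul_rpow ht.le (hx i), mul_left_comm])
    -- On the sphere `N u = 1`, so `k` bounds every coordinate.
    ⟨∑ i, w i * k ^ ξ, fun u hu => Finset.sum_le_sum fun i _ => by
      have h1 : ‖u‖ ≤ k := by simpa [hu.2] using hNk u
      have h2 : u i ≤ k := (le_abs_self _).trans ((norm_le_pi_norm u i).trans h1)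
      have := hw i
      have := hu.1 i
      gcongr⟩
    (.of_forall fun x => hcont.continuousWithinAt)
  refine ⟨hint, ?_⟩
  have h1 := hlim 1 one_pos
  rw [Real.one_rpow, mul_one] at h1
  refine h1.congr' ?_
  filter_upwards [hRV.norm_tendsto.eventually_gt_atTop 0] with n hn
  congr 1
  refine measureReal_congr (hX0.mono fun ω hω => propext ?_)
  change 1 < b n ^ (-ξ) * ∑ i, w i * Z ω i ^ ξ ↔ b n ^ ξ < ∑ i, w i * X ω i
  have h2 : ∀ i, Z ω i ^ ξ = X ω i := fun i => by
    rw [hZ, ← Real.rpow_mul (hω i), one_div_mul_cancel hξ.ne', Real.rpow_one]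
  simp only [h2]
  rw [Real.rpow_neg hn.le, inv_mul_eq_div, one_lt_div (Real.rpow_pos_of_pos hn _)]

/-- A zero integral would force `u i = 0` for almost every direction, so almost every ray would miss
`{x i ≠ 0}`, making that set `ν`-null. -/
theorem setIntegral_posSphere_pos (hRV : IsRegVarying P 1 Z b ν) (N : Seminorm ℝ (Fin d → ℝ))
    (hN : ∀ x, N x = 0 → x = 0) (hZ : ∀ᵐ ω ∂P, 0 ≤ Z ω) {i : Fin d}
    (hi : IntegrableOn (fun u => u i) (posSphere N) (spectralMeasure N ν))
    (hν : ν {x | x i ≠ 0} ≠ 0) : 0 < ∫ u in posSphere N, u i ∂(spectralMeasure N ν) := by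
  have h0 : 0 ≤ᵐ[(spectralMeasure N ν).restrict (posSphere N)] fun u => u i := by
    filter_upwards [ae_restrict_mem (measurableSet_posSphere N)] with u hu using hu.1 i
  refine (integral_nonneg_of_ae h0).lt_of_ne' fun h => hν ?_
  have h1 := (integral_eq_zero_iff_of_nonneg_ae h0 hi).1 h
  have hA : MeasurableSet {x : Fin d → ℝ | x i ≠ 0} :=
    (measurable_pi_apply i (measurableSet_singleton 0)).compl
  rw [hRV.measure_eq_lintegral_polar N hN hZ hA]
  refine mul_eq_zero_of_right _ ?_
  rw [← lintegral_zero]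
  refine lintegral_congr_ae (h1.mono fun u hu => ?_)
  have hu : u i = 0 := hu
  simp [indicator, hu]

end IsRegVarying

theorem propositionA1 {Ω : Type*} [MeasurableSpace Ω] (P : Measure Ω) [IsProbabilityMeasure P]
    {d : ℕ} [NeZero d] (ξ : ℝ) (hξ : 0 < ξ)
    -- the nonnegative losses `X`, and the vector `Z = X^{1/ξ}` in `RV₁({b n}, ν)`
    (X Z : Ω → Fin d → ℝ) (hX : Measurable X) (hX0 : ∀ᵐ ω ∂P, ∀ i, 0 ≤ X ω i)
    (hZ : ∀ ω i, Z ω i = X ω i ^ (1 / ξ))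
    (b : ℕ → ℝ) (ν : Measure (Fin d → ℝ)) (hRV : IsRegVarying P 1 Z b ν)
    -- an arbitrary norm on `ℝ^d`
    (N : Seminorm ℝ (Fin d → ℝ)) (hN : ∀ x, N x = 0 → x = 0) :
    -- the spectral measure is a probability measure on the positive unit sphere, and
    -- `ν(dx) = c r⁻² dr σ(du)` with `c = ν{N > 1}` in `(0, ∞)`
    (IsProbabilityMeasure (spectralMeasure N ν) ∧
      spectralMeasure N ν (posSphere N)ᶜ = 0 ∧
      0 < ν {x | 1 < N x} ∧ ν {x | 1 < N x} < ∞ ∧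
      ∀ A : Set (Fin d → ℝ), MeasurableSet A →
        ν A = ν {x | 1 < N x} *
          ∫⁻ u in posSphere N, (∫⁻ r in Ioi (0 : ℝ),
            A.indicator (fun _ => 1) (r • u) * ENNReal.ofReal (r ^ (-2 : ℝ)))
            ∂(spectralMeasure N ν)) ∧
    -- asymptotic scale of `h(Z)` for a `ξ`-homogeneous risk functional `h`
    (∀ h : (Fin d → ℝ) → ℝ,
      Measurable (fun x : Ici (0 : Fin d → ℝ) => h x) →
      (∀ x, 0 ≤ x → 0 ≤ h x) →
      (∀ t : ℝ, 0 < t → ∀ x, 0 ≤ x → h (t • x) = t ^ ξ * h x) →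
      (∃ M : ℝ, ∀ u ∈ posSphere N, h u ≤ M) →
      (∀ᵐ x ∂ν, ContinuousWithinAt h (Ici 0) x) →
      IntegrableOn (fun u => h u ^ (1 / ξ)) (posSphere N) (spectralMeasure N ν) ∧
      ∀ s : ℝ, 0 < s →
        Tendsto (fun n : ℕ => (n : ℝ) * P.real {ω | s < b n ^ (-ξ) * h (Z ω)}) atTop
          (𝓝 (ν.real {x | 1 < N x} *
            (∫ u in posSphere N, h u ^ (1 / ξ) ∂(spectralMeasure N ν)) * s ^ (-(1 / ξ))))) ∧
    -- the tail ratio of the weighted portfolio and the first asset, when the limit measure is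
    -- not supported on the hyperplane `{x₁ = 0}`
    (ν {x | x 0 ≠ 0} ≠ 0 → ∀ w : Fin d → ℝ, (∀ i, 0 ≤ w i) →
      IntegrableOn (fun u => u 0) (posSphere N) (spectralMeasure N ν) ∧
      0 < ∫ u in posSphere N, u 0 ∂(spectralMeasure N ν) ∧
      IntegrableOn (fun u => (∑ i, w i * u i ^ ξ) ^ (1 / ξ)) (posSphere N)
        (spectralMeasure N ν) ∧
      (∀ x : ℝ, 0 < P.real {ω | x < X ω 0}) ∧
      Tendsto (fun x : ℝ => P.real {ω | x < ∑ i, w i * X ω i} / P.real {ω | x < X ω 0}) atTop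
        (𝓝 (1 / (∫ u in posSphere N, u 0 ∂(spectralMeasure N ν)) *
          ∫ u in posSphere N, (∑ i, w i * u i ^ ξ) ^ (1 / ξ) ∂(spectralMeasure N ν)))) := by
  have hZ0 : ∀ᵐ ω ∂P, 0 ≤ Z ω := hX0.mono fun ω hω i => by
    rw [hZ]
    exact Real.rpow_nonneg (hω i) _
  have hc0 := hRV.measure_one_lt_seminorm_pos N hN
  have hctop := hRV.measure_lt_seminorm_lt_top N one_pos
  refine ⟨⟨hRV.isProbabilityMeasure_spectralMeasure N hN,
    hRV.spectralMeasure_compl_posSphere N hZ0, hc0, hctop,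
    fun A hA => hRV.measure_eq_lintegral_polar N hN hZ0 hA⟩,
    fun h hm h0 hom hM hc => hRV.tendsto_risk_functional N hN hZ0 hξ hm h0 hom hM hc,
    fun hν w hw => ?_⟩
  obtain ⟨hint, hlim⟩ := hRV.tendsto_portfolio N hN hξ hX0 hZ hw
  obtain ⟨hint1, hlim1⟩ := hRV.tendsto_portfolio N hN hξ hX0 hZ (w := Pi.single 0 1)
    fun i => by by_cases hi : i = 0 <;> simp [hi]
  have hS := measurableSet_posSphere N
  have hEq : EqOn (fun u => (∑ i, (Pi.single 0 1 : Fin d → ℝ) i * u i ^ ξ) ^ (1 / ξ))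
      (fun u => u 0) (posSphere N) := fun u hu => by
    simp only [Pi.single_apply, ite_mul, one_mul, zero_mul, Finset.sum_ite_eq', Finset.mem_univ,
      if_true]
    rw [← Real.rpow_mul (hu.1 0), mul_one_div_cancel hξ.ne', Real.rpow_one]
  rw [setIntegral_congr_fun hS hEq] at hlim1
  simp only [Pi.single_apply, ite_mul, one_mul, zero_mul, Finset.sum_ite_eq', Finset.mem_univ,
    if_true] at hlim1
  replace hint1 := hint1.congr_fun hEq hS
  have hσ := hRV.setIntegral_posSphere_pos N hN hZ0 hint1 hν
  have hc : 0 < ν.real {x | 1 < N x} := ENNReal.toReal_pos hc0.ne' hctop.ne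
  refine ⟨hint1, hσ, hint, fun x => ?_, ?_⟩
  -- A positive limit makes the tail positive at some threshold `b n ^ ξ ≥ x`.
  · obtain ⟨n, hn, hx⟩ := ((hlim1.eventually_const_lt (mul_pos hc hσ)).and
      ((hRV.tendsto_norm_rpow hξ).eventually_ge_atTop x)).exists
    exact (pos_of_mul_pos_right hn n.cast_nonneg).trans_le
      (antitone_measureReal_lt P (fun ω => X ω 0) hx)
  · have key := (antitone_measureReal_lt P fun ω => ∑ i, w i * X ω i).tendsto_div_of_tendsto_natCast_mul
      (antitone_measureReal_lt P fun ω => X ω 0) (hRV.monotone_norm_rpow hξ)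
      (hRV.tendsto_norm_rpow hξ) hlim hlim1 (mul_pos hc hσ).ne'
    rwa [mul_div_mul_left _ _ hc.ne', div_eq_inv_mul, ← one_div] at key
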